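/- Let $H^1(\mathbb{R})$ be the Sobolev space of real functions in $L^2(\mathbb{R})$ with weak derivative in $L^2(\mathbb{R})$; its elements are identified with their continuous representatives. Let $\mathcal K_1(t,x)=\frac{e^{-x^2/(4t)}}{\sqrt{4\pi t}}$ be the heat kernel and $(e^{t\Delta}f)(x)=\int_{\mathbb R}\mathcal K_1(t,x-y)f(y)\,dy$ for $t>0$, so that $e^{t\Delta}\delta_0=\mathcal K_1(t,\cdot)$. For $a\in\mathbb R$, $u_0\in H^1(\mathbb R)$ and $\Phi\in L^\infty_{\mathrm{loc}}([0,\infty))$, a mild solution of $$\partial_t u=\partial_x^2u+\bigl(\Phi(t)-a[u(t,1)+u(t,-1)]\bigr)\delta_0,\qquad u(0,\cdot)=u_0,$$ is a continuous map $u:[0,\infty)\to H^1(\mathbb R)$ with $u(0)=u_0$ such that for every $t>0$ $$u(t)=e^{t\Delta}u_0+\int_0^t\bigl(\Phi(\tau)-a[u(\tau,1)+u(\tau,-1)]\bigr)\,e^{(t-\tau)\Delta}\delta_0\,d\tau,$$ the integral being a Bochner integral in $H^1(\mathbb R)$. **Theorem 4.9.** Let $u_0\in H^1(\mathbb R)$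 with $u_0\ge 0$, and let $\Phi\in L^\infty_{\mathrm{loc}}([0,\infty))$ with $\Phi\ge0$ a.e. be of at most exponential order, i.e. there are $\omega\in\mathbb R$ and $t_0\ge0$ such that $e^{-\omega t}\Phi(t)$ is essentially bounded on $[t_0,\infty)$. Let $a\in[0,e^{-1}]$ and let $u$ be a mild solution of the above problem. Then $u_+(t):=u(t,1)+u(t,-1)\ge 0$ for all $t\ge 0$. -/

import Mathlib

open MeasureTheory Set Filter
open scoped ContDiff

namespace NonlocalHeat

noncomputable section

/-- `g` is the weak (distributional) derivative of `f` on the real line. -/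
def HasWeakDeriv (f g : ℝ → ℝ) : Prop :=
  ∀ φ : ℝ → ℝ, ContDiff ℝ ∞ φ → HasCompactSupport φ →
    ∫ x, f x * deriv φ x = -∫ x, g x * φ x

/-- The real Hilbert space of square-integrable functions on the real line. -/
abbrev L2 : Type := Lp ℝ 2 (volume : Measure ℝ)

theorem integrable_L2_mul (f : L2) {φ : ℝ → ℝ} (hφ : Continuous φ) (hc : HasCompactSupport φ) :
    Integrable (fun x => f x * φ x) :=
  (Lp.memLp f).integrable_mul (hφ.memLp_of_hasCompactSupport hc (p := 2) (μ := volume))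

theorem integral_L2_mul (f : L2) {φ : ℝ → ℝ} (hφ : Continuous φ) (hc : HasCompactSupport φ) :
    ∫ x, f x * φ x =
      inner ℝ ((hφ.memLp_of_hasCompactSupport hc (p := 2) (μ := volume)).toLp φ) f := by
  rw [L2.inner_def]
  refine integral_congr_ae ?_
  filter_upwards [(hφ.memLp_of_hasCompactSupport hc (p := 2) (μ := volume)).coeFn_toLp] with x hx
  simp [hx]

theorem deriv_test {φ : ℝ → ℝ} (hφ : ContDiff ℝ ∞ φ) : Continuous (deriv φ) :=
  hφ.continuous_deriv (by simp)

/-- The Sobolev space `H¹(ℝ)`: pairs `(f, f')` of an `L²` function and its weak derivative in `L²`,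
with the norm `(‖f‖² + ‖f'‖²)^(1/2)` induced from the Hilbert sum `L² ⊕ L²`. -/
def sobolevH1 : Submodule ℝ (WithLp 2 (L2 × L2)) where
  carrier := {p | HasWeakDeriv p.fst p.snd}
  zero_mem' := by
    intro φ _ _
    have h0 : ((0 : WithLp 2 (L2 × L2)).fst : ℝ → ℝ) =ᵐ[volume] 0 := Lp.coeFn_zero ℝ 2 volume
    have h1 : ((0 : WithLp 2 (L2 × L2)).snd : ℝ → ℝ) =ᵐ[volume] 0 := Lp.coeFn_zero ℝ 2 volume
    rw [integral_congr_ae (g := fun _ => (0 : ℝ)) (by filter_upwards [h0] with x hx; simp),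
      integral_congr_ae (g := fun _ => (0 : ℝ)) (by filter_upwards [h1] with x hx; simp)]
    simp
  add_mem' := by
    intro p q hp hq φ hφ hc
    have hp' := hp φ hφ hc
    have hq' := hq φ hφ hc
    simp only [integral_L2_mul _ (deriv_test hφ) hc.deriv, integral_L2_mul _ hφ.continuous hc]
      at hp' hq' ⊢
    rw [WithLp.add_fst, WithLp.add_snd, inner_add_right, inner_add_right, hp', hq']
    ring
  smul_mem' := by
    intro c p hp φ hφ hc
    have hp' := hp φ hφ hc
    simp only [integral_L2_mul _ (deriv_test hφ) hc.deriv, integral_L2_mul _ hφ.continuous hc]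
      at hp' ⊢
    rw [WithLp.smul_fst, WithLp.smul_snd, real_inner_smul_right, real_inner_smul_right, hp']
    ring

theorem isClosed_sobolevH1 : IsClosed (sobolevH1 : Set (WithLp 2 (L2 × L2))) := by
  have : (sobolevH1 : Set (WithLp 2 (L2 × L2))) =
      ⋂ (φ : ℝ → ℝ) (_ : ContDiff ℝ ∞ φ) (_ : HasCompactSupport φ),
        {p | ∫ x, p.fst x * deriv φ x = -∫ x, p.snd x * φ x} := by
    ext p
    simp only [mem_iInter]
    rfl
  rw [this]
  refine isClosed_iInter fun φ => isClosed_iInter fun hφ => isClosed_iInter fun hc => ?_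
  simp only [integral_L2_mul _ (deriv_test hφ) hc.deriv, integral_L2_mul _ hφ.continuous hc]
  refine isClosed_eq ?_ ?_
  · exact continuous_const.inner (WithLp.prod_continuous_ofLp 2 _ _).fst
  · exact (continuous_const.inner (WithLp.prod_continuous_ofLp 2 _ _).snd).neg

/-- `H¹(ℝ)` as a Hilbert space. -/
abbrev H1 : Type := sobolevH1

instance : CompleteSpace H1 := isClosed_sobolevH1.completeSpace_coe

/-- The function (up to null sets) underlying an element of `H¹(ℝ)`. -/
def H1.fn (f : H1) : ℝ → ℝ := f.1.fst

theorem integral_primitive_mul_deriv {g : ℝ → ℝ} (hg : LocallyIntegrable g) {φ : ℝ → ℝ}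
    (hφ : ContDiff ℝ ∞ φ) (hc : HasCompactSupport φ) :
    ∫ x, (∫ y in (0 : ℝ)..x, g y) * deriv φ x = -∫ x, g x * φ x := by
  obtain ⟨r, hr⟩ := hc.isCompact.isBounded.subset_closedBall (0 : ℝ)
  set R : ℝ := |r| + 1
  have hR : 0 < R := by positivity
  have hout : ∀ x, x ∉ Ioo (-R) R → x ∉ tsupport φ := by
    intro x hx hx'
    have h := hr hx'
    rw [Metric.mem_closedBall, Real.dist_eq, sub_zero] at h
    exact hx (abs_lt.1 (lt_of_le_of_lt (h.trans (le_abs_self r)) (lt_add_one _)))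
  have hφ0 : ∀ x, x ∉ Ioo (-R) R → φ x = 0 := fun x hx => image_eq_zero_of_notMem_tsupport (hout x hx)
  have hφ1 : ∀ x, x ∉ Ioo (-R) R → deriv φ x = 0 := fun x hx =>
    image_eq_zero_of_notMem_tsupport fun h => hout x hx (tsupport_deriv_subset h)
  have hii : ∀ a b : ℝ, IntervalIntegrable g volume a b := fun a b =>
    (hg.integrableOn_isCompact isCompact_uIcc).intervalIntegrable
  have hac1 : AbsolutelyContinuousOnInterval (fun x => ∫ y in (0 : ℝ)..x, g y) (-R) R :=
    (hii (-R) R).absolutelyContinuousOnInterval_intervalIntegral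
      (by rw [uIcc_of_le (by linarith)]; constructor <;> linarith)
  have hac2 : AbsolutelyContinuousOnInterval φ (-R) R :=
    (hφ.of_le (by norm_cast)).contDiffOn.absolutelyContinuousOnInterval
  have hparts := hac1.integral_mul_deriv_eq_deriv_mul hac2
  rw [hφ0 R (by simp), hφ0 (-R) (by simp)] at hparts
  have hd : ∫ x in (-R)..R, deriv (fun x => ∫ y in (0 : ℝ)..x, g y) x * φ x =
      ∫ x in (-R)..R, g x * φ x := by
    refine intervalIntegral.integral_congr_ae ?_
    have := (hii (-R) R).ae_hasDerivAt_integral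
    filter_upwards [this] with x hx hxm
    rw [(hx (uIoc_subset_uIcc hxm) 0 (by rw [uIcc_of_le (by linarith)]; constructor <;> linarith)).deriv]
  rw [hd] at hparts
  have e1 : ∀ F : ℝ → ℝ, (∀ x, x ∉ Ioo (-R) R → F x = 0) →
      ∫ x in (-R)..R, F x = ∫ x, F x := by
    intro F hF
    rw [intervalIntegral.integral_of_le (by linarith)]
    refine setIntegral_eq_integral_of_forall_compl_eq_zero fun x hx => hF x fun h => hx ?_
    exact Ioo_subset_Ioc_self h
  rw [e1 _ (fun x hx => by rw [hφ1 x hx, mul_zero]), e1 _ (fun x hx => by rw [hφ0 x hx, mul_zero])]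
    at hparts
  linarith

theorem hasCompactSupport_primitive {χ : ℝ → ℝ} (hc : HasCompactSupport χ)
    (h0 : ∫ x, χ x = 0) : HasCompactSupport fun x => ∫ y in Iic x, χ y := by
  obtain ⟨r, hr⟩ := hc.isCompact.isBounded.subset_closedBall (0 : ℝ)
  have hz : ∀ x, r < |x| → χ x = 0 := by
    intro x hx
    refine image_eq_zero_of_notMem_tsupport fun h => ?_
    have h := hr h
    rw [Metric.mem_closedBall, Real.dist_eq, sub_zero] at h
    linarith
  refine HasCompactSupport.intro (isCompact_Icc (a := -|r|) (b := |r|)) fun x hx => ?_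
  have hr' := le_abs_self r
  rcases lt_or_ge x (-|r|) with h | h
  · refine setIntegral_eq_zero_of_forall_eq_zero fun y hy => hz y ?_
    have : y ≤ x := hy
    rw [lt_abs]; right; linarith
  · have hx' : |r| < x := by
      by_contra h'
      exact hx ⟨h, not_lt.1 h'⟩
    rw [setIntegral_eq_integral_of_forall_compl_eq_zero, h0]
    intro y hy
    have : x < y := not_le.1 hy
    refine hz y ?_
    rw [lt_abs]; left; linarith

/-- Du Bois-Reymond: a locally integrable function with vanishing weak derivative is constant. -/
theorem ae_const_of_weakDeriv_zero {h : ℝ → ℝ} (hh : LocallyIntegrable h)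
    (h0 : ∀ φ : ℝ → ℝ, ContDiff ℝ ∞ φ → HasCompactSupport φ → ∫ x, h x * deriv φ x = 0) :
    ∃ c : ℝ, h =ᵐ[volume] fun _ => c := by
  let b : ContDiffBump (0 : ℝ) := default
  have hρ : ContDiff ℝ ∞ (b.normed volume) := b.contDiff_normed
  have hρc : HasCompactSupport (b.normed volume) := b.hasCompactSupport_normed
  have hρ1 : ∫ x, b.normed volume x = 1 := b.integral_normed
  generalize b.normed volume = ρ at hρ hρc hρ1
  refine ⟨∫ x, h x * ρ x, ?_⟩
  set c : ℝ := ∫ x, h x * ρ x with hcdef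
  have hint : ∀ φ : ℝ → ℝ, Continuous φ → HasCompactSupport φ → Integrable fun x => h x * φ x := by
    intro φ hφ hφc
    simpa [mul_comm] using hh.integrable_smul_left_of_hasCompactSupport hφ hφc
  refine ae_eq_of_integral_contDiff_smul_eq hh (locallyIntegrable_const c) fun ψ hψ hψc => ?_
  set m : ℝ := ∫ x, ψ x with hm
  have hψi : Integrable ψ := hψ.continuous.integrable_of_hasCompactSupport hψc
  have hρi : Integrable ρ := hρ.continuous.integrable_of_hasCompactSupport hρc
  let χ : ℝ → ℝ := fun x => ψ x - m * ρ x
  have hχ : ContDiff ℝ ∞ χ := hψ.sub (contDiff_const.mul hρ)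
  have hχc : HasCompactSupport χ := hψc.sub hρc.mul_left
  have hχi : Integrable χ := hψi.sub (hρi.const_mul m)
  have hχ0 : ∫ x, χ x = 0 := by
    simp only [χ]
    rw [integral_sub hψi (hρi.const_mul m), integral_const_mul, hρ1]
    simp [hm]
  have hder : ∀ x, HasDerivAt (fun x => ∫ y in Iic x, χ y) (χ x) x := by
    intro x
    have e : (fun x => ∫ y in Iic x, χ y) = fun x => (∫ y in Iic (0 : ℝ), χ y) + ∫ y in (0 : ℝ)..x, χ y := by
      funext x
      rw [← intervalIntegral.integral_Iic_sub_Iic hχi.integrableOn hχi.integrableOn]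
      ring
    rw [e]
    exact (hχ.continuous.integral_hasStrictDerivAt 0 x).hasDerivAt.const_add _
  have hde : deriv (fun x => ∫ y in Iic x, χ y) = χ := funext fun x => (hder x).deriv
  have hsm : ContDiff ℝ ∞ (fun x => ∫ y in Iic x, χ y) := by
    rw [contDiff_infty_iff_deriv]
    exact ⟨fun x => (hder x).differentiableAt, by rw [hde]; exact hχ⟩
  have key := h0 _ hsm (hasCompactSupport_primitive hχc hχ0)
  rw [hde] at key
  have e2 : (fun x => h x * χ x) = fun x => h x * ψ x - m * (h x * ρ x) := by
    funext x; simp only [χ]; ring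
  rw [e2, integral_sub (hint ψ hψ.continuous hψc) ((hint ρ hρ.continuous hρc).const_mul m),
    integral_const_mul, ← hcdef] at key
  simp only [smul_eq_mul]
  rw [integral_mul_const, ← hm]
  simp only [mul_comm (ψ _)]
  linarith

/-- One-dimensional Sobolev embedding: elements of `H¹(ℝ)` have a continuous representative. -/
theorem exists_continuous_rep (f : H1) : ∃ g : ℝ → ℝ, Continuous g ∧ f.fn =ᵐ[volume] g := by
  have hf : LocallyIntegrable f.fn := (Lp.memLp f.1.fst).locallyIntegrable (by norm_num)
  have hg : LocallyIntegrable (f.1.snd : ℝ → ℝ) := (Lp.memLp f.1.snd).locallyIntegrable (by norm_num)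
  have hii : ∀ a b : ℝ, IntervalIntegrable (f.1.snd : ℝ → ℝ) volume a b := fun a b =>
    (hg.integrableOn_isCompact isCompact_uIcc).intervalIntegrable
  have hcont : Continuous fun x => ∫ y in (0 : ℝ)..x, f.1.snd y :=
    intervalIntegral.continuous_primitive hii 0
  obtain ⟨c, hc⟩ := ae_const_of_weakDeriv_zero (hf.sub hcont.locallyIntegrable) (by
    intro φ hφ hφc
    have h1 := f.2 φ hφ hφc
    have h2 := integral_primitive_mul_deriv hg hφ hφc
    have i1 : Integrable fun x => f.fn x * deriv φ x :=
      integrable_L2_mul f.1.fst (deriv_test hφ) hφc.deriv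
    have i2 : Integrable fun x => (∫ y in (0 : ℝ)..x, f.1.snd y) * deriv φ x :=
      (hcont.mul (deriv_test hφ)).integrable_of_hasCompactSupport hφc.deriv.mul_left
    simp only [Pi.sub_apply, sub_mul]
    rw [integral_sub i1 i2, h2, ← h1]
    exact sub_self _)
  refine ⟨fun x => c + ∫ y in (0 : ℝ)..x, f.1.snd y, continuous_const.add hcont, ?_⟩
  filter_upwards [hc] with x hx
  simp only [Pi.sub_apply] at hx
  linarith

/-- The (unique) continuous representative of an element of `H¹(ℝ)`; `f.rep x` is the point value
of `f` at `x`. -/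
def H1.rep (f : H1) : ℝ → ℝ := (exists_continuous_rep f).choose

theorem H1.continuous_rep (f : H1) : Continuous f.rep := (exists_continuous_rep f).choose_spec.1

theorem H1.fn_ae_eq_rep (f : H1) : f.fn =ᵐ[volume] f.rep := (exists_continuous_rep f).choose_spec.2

/-- The heat kernel on the real line (meaningful for `t > 0`). -/
def heatKernel (t x : ℝ) : ℝ := Real.exp (-x ^ 2 / (4 * t)) / Real.sqrt (4 * Real.pi * t)

/-- The heat semigroup `e^{tΔ}` acting on a function, for `t > 0`. -/
def heatFlow (t : ℝ) (f : ℝ → ℝ) (x : ℝ) : ℝ := ∫ y, heatKernel t (x - y) * f y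

theorem hasDerivAt_heatKernel (t x : ℝ) :
    HasDerivAt (heatKernel t) (-(x / (2 * t)) * heatKernel t x) x := by
  have h : HasDerivAt (fun x : ℝ => -x ^ 2 / (4 * t)) (-(x / (2 * t))) x := by
    have h2 := ((hasDerivAt_pow 2 x).fun_neg).div_const (4 * t)
    have e : -((2 : ℕ) * x ^ (2 - 1)) / (4 * t) = -(x / (2 * t)) := by
      rcases eq_or_ne t 0 with rfl | ht
      · simp
      · push_cast
        field_simp
        ring
    rwa [e] at h2
  have h3 := h.exp.div_const (Real.sqrt (4 * Real.pi * t))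
  have e : Real.exp (-x ^ 2 / (4 * t)) * -(x / (2 * t)) / Real.sqrt (4 * Real.pi * t) =
      -(x / (2 * t)) * heatKernel t x := by
    simp only [heatKernel]
    ring
  rwa [e] at h3

theorem continuous_heatKernel (t : ℝ) : Continuous (heatKernel t) :=
  continuous_iff_continuousAt.2 fun x => (hasDerivAt_heatKernel t x).continuousAt

theorem memLp_heatKernel {t : ℝ} (ht : 0 < t) : MemLp (heatKernel t) 2 := by
  rw [memLp_two_iff_integrable_sq (continuous_heatKernel t).aestronglyMeasurable]
  have h := (integrable_exp_neg_mul_sq (b := 1 / (2 * t)) (by positivity)).div_const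
    (Real.sqrt (4 * Real.pi * t) ^ 2)
  refine h.congr (Eventually.of_forall fun x => ?_)
  simp only [heatKernel, div_pow, ← Real.exp_nat_mul]
  congr 2
  push_cast
  field_simp
  ring

theorem memLp_deriv_heatKernel {t : ℝ} (ht : 0 < t) :
    MemLp (fun x => -(x / (2 * t)) * heatKernel t x) 2 := by
  have hcont : Continuous fun x => -(x / (2 * t)) * heatKernel t x :=
    (continuous_id.div_const _).neg.mul (continuous_heatKernel t)
  rw [memLp_two_iff_integrable_sq hcont.aestronglyMeasurable]
  have h := ((integrable_rpow_mul_exp_neg_mul_sq (b := 1 / (2 * t)) (by positivity)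
    (s := 2) (by norm_num)).div_const (Real.sqrt (4 * Real.pi * t) ^ 2)).const_mul (1 / (2 * t) ^ 2)
  refine h.congr (Eventually.of_forall fun x => ?_)
  have e : Real.exp (-(1 / (2 * t)) * x ^ 2) = Real.exp (-x ^ 2 / (4 * t)) ^ 2 := by
    rw [← Real.exp_nat_mul]
    congr 1
    push_cast
    field_simp
    ring
  simp only [heatKernel]
  rw [e, Real.rpow_two]
  ring

theorem hasWeakDeriv_of_hasDerivAt {f g : ℝ → ℝ} (hf : ∀ x, HasDerivAt f (g x) x)
    (hg : Continuous g) : HasWeakDeriv f g := by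
  intro φ hφ hc
  have hfc : Continuous f := continuous_iff_continuousAt.2 fun x => (hf x).continuousAt
  exact integral_mul_deriv_eq_deriv_mul_of_integrable (fun x _ => hf x)
    (fun x _ => (hφ.differentiable (by simp) x).hasDerivAt)
    ((hfc.mul (deriv_test hφ)).integrable_of_hasCompactSupport hc.deriv.mul_left)
    ((hg.mul hφ.continuous).integrable_of_hasCompactSupport hc.mul_left)
    ((hfc.mul hφ.continuous).integrable_of_hasCompactSupport hc.mul_left)

theorem hasWeakDeriv_congr {f f' g g' : ℝ → ℝ} (hf : f =ᵐ[volume] f') (hg : g =ᵐ[volume] g')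
    (h : HasWeakDeriv f g) : HasWeakDeriv f' g' := by
  intro φ hφ hc
  have h1 : ∫ x, f x * deriv φ x = ∫ x, f' x * deriv φ x :=
    integral_congr_ae (hf.mul (ae_eq_refl _))
  have h2 : ∫ x, g x * φ x = ∫ x, g' x * φ x := integral_congr_ae (hg.mul (ae_eq_refl _))
  rw [← h1, ← h2]
  exact h φ hφ hc

/-- The heat kernel is the heat semigroup applied to the Dirac measure at the origin. -/
theorem heatKernel_eq_integral_dirac (t x : ℝ) :
    ∫ y, heatKernel t (x - y) ∂(Measure.dirac 0) = heatKernel t x := by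
  simp

/-- For `t > 0`, the heat kernel `e^{tΔ} δ₀` as an element of `H¹(ℝ)`. (Junk value `0` for `t ≤ 0`.)
-/
def heatKernelH1 (t : ℝ) : H1 :=
  if ht : 0 < t then
    ⟨WithLp.toLp 2 ((memLp_heatKernel ht).toLp _, (memLp_deriv_heatKernel ht).toLp _),
      hasWeakDeriv_congr (memLp_heatKernel ht).coeFn_toLp.symm
        (memLp_deriv_heatKernel ht).coeFn_toLp.symm
        (hasWeakDeriv_of_hasDerivAt (hasDerivAt_heatKernel t)
          ((continuous_id.div_const _).neg.mul (continuous_heatKernel t)))⟩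
  else 0

theorem heatKernelH1_fn {t : ℝ} (ht : 0 < t) : (heatKernelH1 t).fn =ᵐ[volume] heatKernel t := by
  simp only [H1.fn, heatKernelH1, dif_pos ht]
  exact (memLp_heatKernel ht).coeFn_toLp

/-- `Φ` belongs to `L^∞_loc([0, ∞))`. -/
def IsLocBounded (Φ : ℝ → ℝ) : Prop :=
  ∀ t₀ t₁ : ℝ, 0 ≤ t₀ → t₀ ≤ t₁ → MemLp Φ ⊤ (volume.restrict (Icc t₀ t₁))

/-- `Φ` is of at most exponential order: for some `w`, the function `e^{-wt} Φ(t)` is essentially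
bounded on some half-line `[t₀, ∞)`. -/
def IsExpOrder (Φ : ℝ → ℝ) : Prop :=
  ∃ w t₀ M : ℝ, 0 ≤ t₀ ∧ ∀ᵐ t : ℝ, t₀ ≤ t → |Real.exp (-w * t) * Φ t| ≤ M

/-- `u₊(t) = u(t, 1) + u(t, -1)`. -/
def uPlus (u : ℝ → H1) (t : ℝ) : ℝ := (u t).rep 1 + (u t).rep (-1)

/-- The intensity `Ψ_t[u] = Φ(t) - a (u(t, 1) + u(t, -1))` of the Dirac source. -/
def intensity (a : ℝ) (Φ : ℝ → ℝ) (u : ℝ → H1) (t : ℝ) : ℝ := Φ t - a * uPlus u t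

/-- `u ∈ C([0, ∞), H¹(ℝ))` is a mild solution of
`∂ₜ u = ∂ₓ² u + (Φ(t) - a (u(t, 1) + u(t, -1))) δ₀`, `u(0) = u₀`:
it satisfies the variation of constants formula
`u(t) = e^{tΔ} u₀ + ∫₀ᵗ Ψ_τ[u] e^{(t-τ)Δ} δ₀ dτ`, with a Bochner integral in `H¹(ℝ)`.
(Only the values of `u` on `[0, ∞)` matter.) -/
structure IsMildSolution (a : ℝ) (Φ : ℝ → ℝ) (u₀ : H1) (u : ℝ → H1) : Prop where
  continuousOn : ContinuousOn u (Ici 0)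
  initial : u 0 = u₀
  integrable : ∀ t, 0 < t →
    IntegrableOn (fun τ => intensity a Φ u τ • heatKernelH1 (t - τ)) (Ioo 0 t)
  variation_of_constants : ∀ t, 0 < t →
    (u t).fn =ᵐ[volume] fun x => heatFlow t u₀.fn x +
      H1.fn (∫ τ in Ioo 0 t, intensity a Φ u τ • heatKernelH1 (t - τ)) x

end

end NonlocalHeat

/-!
The quantity `u₊` solves a Volterra equation `u₊ = g + k ⋆ (Φ - a u₊)` whose kernel `k = 2 K(·, 1)`
is, as a function of time, the heat kernel of the half-line with reflecting boundary, and whose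
forcing `g` is the free heat flow of `u₀` at `1` and `-1`. Hence `u₊ = (g - a r ⋆ g) + r ⋆ Φ` with
`r` the resolvent of `k`. First-passage densities turn convolution in time into translation in
space (strong Markov property), so `r` is obtained by subordinating them to the solution `Y` of the
delay equation `Y' = -a Y(· - 1)`, `Y = 1` on `(-∞, 1]`. The condition `a ≤ e⁻¹` is exactly
non-oscillation of this equation: it gives `Y ≥ 0`, hence `r ≥ 0`, and likewise `a r ⋆ g ≤ g`.
-/

open scoped Topology

namespace NonlocalHeat

noncomputable section

theorem heatKernel_eq_gaussianPDFReal (t : ℝ) :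
    heatKernel t = ProbabilityTheory.gaussianPDFReal 0 (2 * t).toNNReal := by
  ext x
  rcases le_total t 0 with ht | ht
  · have hsqrt : √(4 * Real.pi * t) = 0 :=
      Real.sqrt_eq_zero_of_nonpos (mul_nonpos_of_nonneg_of_nonpos (by positivity) ht)
    rw [Real.toNNReal_of_nonpos (by linarith), ProbabilityTheory.gaussianPDFReal_zero_var,
      Pi.zero_apply, heatKernel, hsqrt, div_zero]
  · rw [heatKernel, ProbabilityTheory.gaussianPDFReal, Real.coe_toNNReal _ (by positivity),
      sub_zero, div_eq_inv_mul]
    ring_nf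

theorem heatKernel_of_nonpos {t : ℝ} (ht : t ≤ 0) (x : ℝ) : heatKernel t x = 0 := by
  rw [heatKernel_eq_gaussianPDFReal, Real.toNNReal_of_nonpos (by linarith),
    ProbabilityTheory.gaussianPDFReal_zero_var, Pi.zero_apply]

theorem heatKernel_nonneg (t x : ℝ) : 0 ≤ heatKernel t x := by
  rw [heatKernel_eq_gaussianPDFReal]
  exact ProbabilityTheory.gaussianPDFReal_nonneg _ _ _

theorem integrable_heatKernel (t : ℝ) : Integrable (heatKernel t) := by
  rw [heatKernel_eq_gaussianPDFReal]
  exact ProbabilityTheory.integrable_gaussianPDFReal _ _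

theorem integral_heatKernel {t : ℝ} (ht : 0 < t) : ∫ x, heatKernel t x = 1 := by
  rw [heatKernel_eq_gaussianPDFReal]
  exact ProbabilityTheory.integral_gaussianPDFReal_eq_one _ (by simpa using ht)

theorem heatKernel_neg (t x : ℝ) : heatKernel t (-x) = heatKernel t x := by
  simp only [heatKernel, neg_sq]

theorem heatKernel_abs (t x : ℝ) : heatKernel t |x| = heatKernel t x := by
  simp only [heatKernel, sq_abs]

theorem heatKernel_le_inv_abs (t : ℝ) {x : ℝ} (hx : x ≠ 0) : heatKernel t x ≤ |x|⁻¹ := by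
  rcases le_or_gt t 0 with ht | ht
  · rw [heatKernel_of_nonpos ht]
    positivity
  set y := x ^ 2 / (4 * t) with hy
  have hexp : Real.exp (-y) ≤ 1 := Real.exp_le_one_iff.2 (by rw [neg_nonpos]; positivity)
  have hmul : y * Real.exp (-y) ≤ 1 :=
    (Real.mul_exp_neg_le_exp_neg_one y).trans (Real.exp_le_one_iff.2 (by norm_num))
  rw [heatKernel, neg_div, ← hy, ← one_div, div_le_div_iff₀ (by positivity) (abs_pos.2 hx),
    one_mul]
  refine Real.le_sqrt_of_sq_le ?_
  calc (Real.exp (-y) * |x|) ^ 2 = 4 * t * (y * Real.exp (-y) * Real.exp (-y)) := by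
        rw [mul_pow, sq_abs, hy]
        field_simp
    _ ≤ 4 * t * (1 * 1) := by gcongr
    _ ≤ 4 * Real.pi * t := by nlinarith [Real.pi_gt_three]

theorem tendsto_heatKernel_atTop (t : ℝ) : Tendsto (heatKernel t) atTop (𝓝 0) := by
  refine squeeze_zero' (.of_forall fun x => heatKernel_nonneg t x) ?_
    (tendsto_inv_atTop_zero.comp tendsto_abs_atTop_atTop)
  filter_upwards [eventually_ne_atTop 0] with x hx using heatKernel_le_inv_abs t hx

/-- The heat kernel of the half-line with reflecting (Neumann) boundary condition, as a function
of time at distance `b` from the boundary. -/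
def reflectedKernel (b t : ℝ) : ℝ := 2 * heatKernel t b

/-- The density at time `t` of the first passage at distance `b` of the heat process. -/
def passageDensity (b t : ℝ) : ℝ := b / t * heatKernel t b

theorem measurable_passageDensity_uncurry :
    Measurable fun p : ℝ × ℝ => passageDensity p.1 p.2 := by
  fun_prop [passageDensity, heatKernel]

theorem measurable_reflectedKernel (b : ℝ) : Measurable (reflectedKernel b) := by
  fun_prop [reflectedKernel, heatKernel]

theorem reflectedKernel_nonneg (b t : ℝ) : 0 ≤ reflectedKernel b t :=
  mul_nonneg zero_le_two (heatKernel_nonneg t b)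

theorem abs_reflectedKernel_le {b : ℝ} (hb : b ≠ 0) (t : ℝ) :
    |reflectedKernel b t| ≤ 2 * |b|⁻¹ := by
  rw [abs_of_nonneg (reflectedKernel_nonneg b t)]
  exact mul_le_mul_of_nonneg_left (heatKernel_le_inv_abs t hb) zero_le_two

theorem reflectedKernel_of_nonpos (b : ℝ) {t : ℝ} (ht : t ≤ 0) : reflectedKernel b t = 0 := by
  rw [reflectedKernel, heatKernel_of_nonpos ht, mul_zero]

theorem tendsto_reflectedKernel_atTop (t : ℝ) :
    Tendsto (fun b => reflectedKernel b t) atTop (𝓝 0) := by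
  simpa only [mul_zero] using! (tendsto_heatKernel_atTop t).const_mul 2

theorem passageDensity_of_nonpos (b : ℝ) {t : ℝ} (ht : t ≤ 0) : passageDensity b t = 0 := by
  rw [passageDensity, heatKernel_of_nonpos ht, mul_zero]

theorem passageDensity_nonneg {b : ℝ} (hb : 0 ≤ b) (t : ℝ) : 0 ≤ passageDensity b t := by
  rcases le_total t 0 with ht | ht
  · exact (passageDensity_of_nonpos b ht).ge
  · exact mul_nonneg (div_nonneg hb ht) (heatKernel_nonneg t b)

theorem hasDerivAt_reflectedKernel (b t : ℝ) :
    HasDerivAt (fun b => reflectedKernel b t) (-passageDensity b t) b := by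
  refine ((hasDerivAt_heatKernel t b).const_mul 2).congr_deriv ?_
  rw [passageDensity]
  ring

section Level

variable {b t : ℝ}

theorem hasDerivAt_neg_reflectedKernel_add (s : ℝ) :
    HasDerivAt (fun s => -reflectedKernel (s + b) t) (passageDensity (s + b) t) s :=
  ((hasDerivAt_reflectedKernel (s + b) t).comp_add_const s b).neg.congr_deriv (neg_neg _)

theorem tendsto_neg_reflectedKernel_add :
    Tendsto (fun s => -reflectedKernel (s + b) t) atTop (𝓝 0) := by
  simpa only [neg_zero] using! ((tendsto_reflectedKernel_atTop t).comp
    (tendsto_atTop_add_const_right atTop b tendsto_id)).neg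

theorem integrableOn_passageDensity_add (hb : 0 ≤ b) :
    IntegrableOn (fun s => passageDensity (s + b) t) (Ioi 0) :=
  integrableOn_Ioi_deriv_of_nonneg' (fun s _ => hasDerivAt_neg_reflectedKernel_add s)
    (fun _ hs => passageDensity_nonneg (add_nonneg (mem_Ioi.1 hs).le hb) t)
    tendsto_neg_reflectedKernel_add

theorem integral_passageDensity_add (hb : 0 ≤ b) :
    ∫ s in Ioi 0, passageDensity (s + b) t = reflectedKernel b t := by
  rw [integral_Ioi_of_hasDerivAt_of_nonneg' (fun s _ => hasDerivAt_neg_reflectedKernel_add s)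
    (fun _ hs => passageDensity_nonneg (add_nonneg (mem_Ioi.1 hs).le hb) t)
    tendsto_neg_reflectedKernel_add, zero_add, zero_sub, neg_neg]

end Level

/-! ### Causal convolution and Volterra equations -/

/-- The convolution `∫₀ᵗ f (t - s) g s ds` of two functions of time `t ≥ 0`. -/
def causalConv (f g : ℝ → ℝ) (t : ℝ) : ℝ := ∫ s in Ioo 0 t, f (t - s) * g s

theorem causalConv_comm (f g : ℝ → ℝ) (t : ℝ) : causalConv f g t = causalConv g f t := by
  rcases le_total t 0 with ht | ht
  · simp only [causalConv, Ioo_eq_empty_of_le ht, setIntegral_empty]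
  · simp only [causalConv, ← integral_Ioc_eq_integral_Ioo, ← intervalIntegral.integral_of_le ht]
    simpa only [sub_sub_cancel, sub_self, sub_zero, mul_comm] using
      (intervalIntegral.integral_comp_sub_left (fun s => f (t - s) * g s) t (a := 0) (b := t)).symm

theorem causalConv_congr {f g g' : ℝ → ℝ} {t : ℝ} (h : EqOn g g' (Ioo 0 t)) :
    causalConv f g t = causalConv f g' t :=
  setIntegral_congr_fun measurableSet_Ioo fun s hs => congrArg (f (t - s) * ·) (h hs)

theorem causalConv_nonneg {f g : ℝ → ℝ} (hf : ∀ s, 0 ≤ f s) (hg : ∀ᵐ s, 0 ≤ s → 0 ≤ g s)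
    (t : ℝ) : 0 ≤ causalConv f g t := by
  refine setIntegral_nonneg_of_ae_restrict ?_
  filter_upwards [ae_restrict_mem measurableSet_Ioo, ae_restrict_of_ae hg] with s hs hgs
  exact mul_nonneg (hf _) (hgs hs.1.le)

theorem causalConv_eq_setIntegral {f : ℝ → ℝ} (hf₀ : ∀ s ≤ 0, f s = 0) (g : ℝ → ℝ) {s t : ℝ}
    (hst : s ≤ t) : causalConv f g s = ∫ τ in Ioo 0 t, f (s - τ) * g τ := by
  refine (setIntegral_eq_of_subset_of_forall_sdiff_eq_zero measurableSet_Ioo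
    (Ioo_subset_Ioo_right hst) fun τ hτ => ?_).symm
  have hsτ : s ≤ τ := not_lt.1 fun h => hτ.2 ⟨hτ.1.1, h⟩
  rw [hf₀ _ (sub_nonpos.2 hsτ), zero_mul]

theorem causalConv_comp_sub {g : ℝ → ℝ} (hg₀ : ∀ s ≤ 0, g s = 0) (f : ℝ → ℝ) {τ t : ℝ}
    (hτ : 0 ≤ τ) : causalConv f (fun s => g (s - τ)) t = causalConv f g (t - τ) := by
  rw [causalConv_comm, causalConv_comm f, causalConv_eq_setIntegral hg₀ f (sub_le_self t hτ)]
  simp only [causalConv, sub_right_comm t _ τ]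

section BoundedKernel

variable {f : ℝ → ℝ} {C : ℝ} {t : ℝ} (hf : Measurable f) (hfC : ∀ s, |f s| ≤ C)

include hf hfC

theorem integrableOn_causalConv {g : ℝ → ℝ} (hg : IntegrableOn g (Ioo 0 t)) :
    IntegrableOn (fun s => f (t - s) * g s) (Ioo 0 t) :=
  hg.bdd_mul (hf.comp (measurable_const.sub measurable_id)).aestronglyMeasurable
    (.of_forall fun s => hfC (t - s))

theorem causalConv_add {g h : ℝ → ℝ} (hg : IntegrableOn g (Ioo 0 t))
    (hh : IntegrableOn h (Ioo 0 t)) :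
    causalConv f (fun s => g s + h s) t = causalConv f g t + causalConv f h t := by
  simp only [causalConv, mul_add]
  exact integral_add (integrableOn_causalConv hf hfC hg) (integrableOn_causalConv hf hfC hh)

theorem causalConv_sub {g h : ℝ → ℝ} (hg : IntegrableOn g (Ioo 0 t))
    (hh : IntegrableOn h (Ioo 0 t)) :
    causalConv f (fun s => g s - h s) t = causalConv f g t - causalConv f h t := by
  simp only [causalConv, mul_sub]
  exact integral_sub (integrableOn_causalConv hf hfC hg) (integrableOn_causalConv hf hfC hh)

theorem causalConv_integral {Y : Type*} [MeasurableSpace Y] {μ : Measure Y} [SFinite μ]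
    {F : ℝ → Y → ℝ} (hF : Integrable F.uncurry ((volume.restrict (Ioo 0 t)).prod μ)) :
    causalConv f (fun s => ∫ y, F s y ∂μ) t = ∫ y, causalConv f (fun s => F s y) t ∂μ := by
  have hint : Integrable (Function.uncurry fun s y => f (t - s) * F s y)
      ((volume.restrict (Ioo 0 t)).prod μ) :=
    hF.bdd_mul (hf.comp (measurable_const.sub measurable_fst)).aestronglyMeasurable
      (.of_forall fun p => hfC (t - p.1))
  simp only [causalConv, ← integral_const_mul]
  exact integral_integral_swap hint

theorem causalConv_assoc {g h : ℝ → ℝ} {D : ℝ} (hg : Measurable g) (hgD : ∀ s, |g s| ≤ D)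
    (hg₀ : ∀ s ≤ 0, g s = 0) (hh : IntegrableOn h (Ioo 0 t)) :
    causalConv f (causalConv g h) t = causalConv (causalConv f g) h t := by
  have hF : Integrable (Function.uncurry fun s τ => g (s - τ) * h τ)
      ((volume.restrict (Ioo 0 t)).prod (volume.restrict (Ioo 0 t))) :=
    (hh.comp_snd _).bdd_mul (hg.comp (measurable_fst.sub measurable_snd)).aestronglyMeasurable
      (.of_forall fun p => hgD (p.1 - p.2))
  calc causalConv f (causalConv g h) t
      = causalConv f (fun s => ∫ τ in Ioo 0 t, g (s - τ) * h τ) t :=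
        causalConv_congr fun s hs => causalConv_eq_setIntegral hg₀ h hs.2.le
    _ = ∫ τ in Ioo 0 t, causalConv f (fun s => g (s - τ) * h τ) t :=
        causalConv_integral hf hfC hF
    _ = causalConv (causalConv f g) h t := by
        refine setIntegral_congr_fun measurableSet_Ioo fun τ hτ => ?_
        rw [← causalConv_comp_sub hg₀ f hτ.1.le]
        simp only [causalConv, ← mul_assoc, integral_mul_const]

end BoundedKernel

theorem integrable_uncurry_of_integral_le {X Y : Type*} [MeasurableSpace X] [MeasurableSpace Y]
    {μ : Measure X} [IsFiniteMeasure μ] {ν : Measure Y} [SFinite ν] {F : X → Y → ℝ} {C : ℝ}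
    (hF : Measurable F.uncurry) (hF₀ : ∀ᵐ x ∂μ, 0 ≤ᵐ[ν] F x) (hFi : ∀ᵐ x ∂μ, Integrable (F x) ν)
    (hFC : ∀ᵐ x ∂μ, ∫ y, F x y ∂ν ≤ C) : Integrable F.uncurry (μ.prod ν) := by
  have hmeas : AEStronglyMeasurable F.uncurry (μ.prod ν) := hF.aestronglyMeasurable
  refine (integrable_prod_iff hmeas).2 ⟨hFi, .of_bound hmeas.norm.integral_prod_right' C ?_⟩
  filter_upwards [hF₀, hFC] with x hx₀ hxC
  rw [Real.norm_of_nonneg (integral_nonneg fun y => norm_nonneg _)]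
  refine (integral_congr_ae ?_).trans_le hxC
  filter_upwards [hx₀] with y hy using Real.norm_of_nonneg hy

section Volterra

variable {a C D t : ℝ} {k r f g p : ℝ → ℝ}
  (hk : Measurable k) (hkC : ∀ s, |k s| ≤ C) (hk₀ : ∀ s ≤ 0, k s = 0)
  (hr : Measurable r) (hrD : ∀ s, |r s| ≤ D)
  (hf : IntegrableOn f (Ioo 0 t)) (hg : IntegrableOn g (Ioo 0 t)) (hp : IntegrableOn p (Ioo 0 t))

include hk hkC hk₀ hr hrD hf hg hp

theorem eq_of_volterra_of_resolvent (hresolvent : ∀ s, a * causalConv r k s = k s - r s)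
    (hvolterra : ∀ s ∈ Ioc 0 t, p s = g s + causalConv k (fun τ => f τ - a * p τ) s)
    (ht : 0 < t) : p t = g t - a * causalConv r g t + causalConv r f t := by
  set w : ℝ → ℝ := fun τ => f τ - a * p τ
  have hw : IntegrableOn w (Ioo 0 t) := hf.sub (hp.const_mul a)
  have hrw : causalConv r w t = causalConv r f t - a * causalConv r p t := by
    rw [causalConv_sub hr hrD hf (hp.const_mul a)]
    simp only [causalConv, mul_left_comm _ a, integral_const_mul]
  have hrk : a * causalConv (causalConv r k) w t = causalConv k w t - causalConv r w t := by
    rw [causalConv, ← integral_const_mul]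
    simp only [← mul_assoc, hresolvent, sub_mul]
    exact integral_sub (integrableOn_causalConv hk hkC hw) (integrableOn_causalConv hr hrD hw)
  have hrp : causalConv r p t = causalConv r g t + causalConv (causalConv r k) w t := by
    have hkw : causalConv r (causalConv k w) t = causalConv r p t - causalConv r g t := by
      rw [← causalConv_sub hr hrD hp hg]
      refine causalConv_congr fun s hs => ?_
      rw [hvolterra s ⟨hs.1, hs.2.le⟩, add_sub_cancel_left]
    rw [← causalConv_assoc hr hrD hk hkC hk₀ hw, hkw, add_sub_cancel]
  have hpt := hvolterra t ⟨ht, le_rfl⟩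
  linear_combination hpt - a * hrp - hrk + hrw

end Volterra

/-! ### The Cauchy–Schlömilch integral and the strong Markov property -/

/-- The primitive `∫₀ᶻ e^{-w²} dw` of the Gaussian, an unnormalised error function. -/
def gaussPrimitive (z : ℝ) : ℝ := ∫ w in (0)..z, Real.exp (-w ^ 2)

theorem hasDerivAt_gaussPrimitive (z : ℝ) :
    HasDerivAt gaussPrimitive (Real.exp (-z ^ 2)) z :=
  (Continuous.integral_hasStrictDerivAt (by fun_prop) 0 z).hasDerivAt

theorem tendsto_gaussPrimitive_atTop : Tendsto gaussPrimitive atTop (𝓝 (√Real.pi / 2)) := by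
  have h := intervalIntegral_tendsto_integral_Ioi 0
    (integrable_exp_neg_mul_sq one_pos).integrableOn tendsto_id
  rw [integral_gaussian_Ioi, div_one] at h
  simpa only [neg_mul, one_mul] using! h

theorem tendsto_gaussPrimitive_atBot : Tendsto gaussPrimitive atBot (𝓝 (-(√Real.pi / 2))) := by
  refine (tendsto_gaussPrimitive_atTop.comp tendsto_neg_atBot_atTop).neg.congr fun z => ?_
  have h := intervalIntegral.integral_comp_neg (a := 0) (b := z) fun w : ℝ => Real.exp (-w ^ 2)
  simp only [neg_sq, neg_zero] at h
  rw [Function.comp_apply, gaussPrimitive, gaussPrimitive, h,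
    intervalIntegral.integral_symm, neg_neg]

/-- A primitive of `x ↦ e^{-(α x)² - (β / x)²}` on `(0, ∞)`, with the constant factor cleared. -/
def schlomilchPrimitive (α β x : ℝ) : ℝ :=
  Real.exp (-(2 * α * β)) * gaussPrimitive (α * x - β / x) +
    Real.exp (2 * α * β) * gaussPrimitive (α * x + β / x)

section CauchySchlomilch

variable {α β : ℝ}

theorem hasDerivAt_schlomilchPrimitive (α β : ℝ) {x : ℝ} (hx : x ≠ 0) :
    HasDerivAt (schlomilchPrimitive α β) (2 * α * Real.exp (-(α * x) ^ 2 - (β / x) ^ 2)) x := by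
  have hlin : HasDerivAt (fun x => α * x) α x := by
    simpa only [mul_one] using (hasDerivAt_id' x).const_mul α
  have hinv : HasDerivAt (fun x => β / x) (-(β / x ^ 2)) x := by
    simpa only [mul_neg, div_eq_mul_inv] using! (hasDerivAt_inv hx).const_mul β
  have hsub := (hasDerivAt_gaussPrimitive (α * x - β / x)).comp x (hlin.sub hinv)
  have hadd := (hasDerivAt_gaussPrimitive (α * x + β / x)).comp x (hlin.add hinv)
  refine ((hsub.const_mul _).add (hadd.const_mul _)).congr_deriv ?_
  have hcancel : α * x * (β / x) = α * β := by field_simp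
  have hexp_sub : Real.exp (-(2 * α * β)) * Real.exp (-(α * x - β / x) ^ 2) =
      Real.exp (-(α * x) ^ 2 - (β / x) ^ 2) := by
    rw [← Real.exp_add]
    congr 1
    linear_combination 2 * hcancel
  have hexp_add : Real.exp (2 * α * β) * Real.exp (-(α * x + β / x) ^ 2) =
      Real.exp (-(α * x) ^ 2 - (β / x) ^ 2) := by
    rw [← Real.exp_add]
    congr 1
    linear_combination -2 * hcancel
  rw [← mul_assoc, ← mul_assoc, hexp_sub, hexp_add]
  ring

theorem tendsto_schlomilchPrimitive_atTop (hα : 0 < α) (β : ℝ) :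
    Tendsto (schlomilchPrimitive α β) atTop
      (𝓝 (Real.exp (-(2 * α * β)) * (√Real.pi / 2) + Real.exp (2 * α * β) * (√Real.pi / 2))) := by
  have hlin : Tendsto (fun x => α * x) atTop atTop := tendsto_id.const_mul_atTop hα
  have hinv : Tendsto (fun x => β / x) atTop (𝓝 0) := tendsto_const_nhds.div_atTop tendsto_id
  refine ((tendsto_gaussPrimitive_atTop.comp ?_).const_mul _).add
    ((tendsto_gaussPrimitive_atTop.comp (hlin.atTop_add hinv)).const_mul _)
  simpa only [sub_eq_add_neg] using hlin.atTop_add hinv.neg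

theorem tendsto_schlomilchPrimitive_zero (α : ℝ) (hβ : 0 < β) :
    Tendsto (schlomilchPrimitive α β) (𝓝[>] 0)
      (𝓝 (Real.exp (-(2 * α * β)) * -(√Real.pi / 2) +
        Real.exp (2 * α * β) * (√Real.pi / 2))) := by
  have hlin : Tendsto (fun x => α * x) (𝓝[>] 0) (𝓝 0) :=
    ((continuous_const_mul α).tendsto' 0 0 (mul_zero α)).mono_left nhdsWithin_le_nhds
  have hinv : Tendsto (fun x => β / x) (𝓝[>] 0) atTop := by
    simpa only [div_eq_mul_inv] using tendsto_inv_nhdsGT_zero.const_mul_atTop hβ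
  refine ((tendsto_gaussPrimitive_atBot.comp ?_).const_mul _).add
    ((tendsto_gaussPrimitive_atTop.comp (hlin.add_atTop hinv)).const_mul _)
  simpa only [sub_eq_add_neg] using! hlin.add_atBot (tendsto_neg_atTop_atBot.comp hinv)

theorem integral_exp_neg_sq_sub_inv_sq (hα : 0 < α) (hβ : 0 < β) :
    ∫ x in Ioi 0, Real.exp (-(α * x) ^ 2 - (β / x) ^ 2) =
      √Real.pi / (2 * α) * Real.exp (-(2 * α * β)) := by
  have hint : IntegrableOn (fun x => Real.exp (-(α * x) ^ 2 - (β / x) ^ 2)) (Ioi 0) := by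
    have hmeas : Measurable fun x => Real.exp (-(α * x) ^ 2 - (β / x) ^ 2) := by fun_prop
    refine (integrable_exp_neg_mul_sq (sq_pos_of_pos hα)).integrableOn.mono'
      hmeas.aestronglyMeasurable (.of_forall fun x => ?_)
    rw [Real.norm_of_nonneg (Real.exp_pos _).le]
    exact Real.exp_le_exp.2 (by nlinarith [sq_nonneg (β / x)])
  have h := integral_Ioi_deriv_mul_eq_sub (v := 1) (v' := 0)
    (fun x hx => hasDerivAt_schlomilchPrimitive α β (ne_of_gt hx))
    (fun x _ => hasDerivAt_const x 1)
    (by simpa only [mul_one, mul_zero, add_zero] using! hint.const_mul (2 * α))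
    (by simpa only [mul_one] using tendsto_schlomilchPrimitive_zero α hβ)
    (by simpa only [mul_one] using tendsto_schlomilchPrimitive_atTop hα β)
  simp only [Pi.one_apply, Pi.zero_apply, mul_one, mul_zero, add_zero, integral_const_mul] at h
  rw [div_mul_eq_mul_div, eq_div_iff (by positivity)]
  linear_combination h

end CauchySchlomilch

section TimeChange

variable {t : ℝ}

theorem hasDerivAt_div_one_add_sq (t x : ℝ) :
    HasDerivAt (fun x => t / (1 + x ^ 2)) (-(2 * t * x / (1 + x ^ 2) ^ 2)) x := by
  refine ((hasDerivAt_const x t).div ((hasDerivAt_pow 2 x).const_add 1)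
    (by positivity)).congr_deriv ?_
  push_cast
  ring

theorem antitoneOn_div_one_add_sq (ht : 0 < t) :
    AntitoneOn (fun x => t / (1 + x ^ 2)) (Ioi 0) := by
  intro x hx y _ hxy
  have hx₀ : 0 ≤ x := (mem_Ioi.1 hx).le
  dsimp only
  gcongr

theorem image_div_one_add_sq_Ioi (ht : 0 < t) :
    (fun x => t / (1 + x ^ 2)) '' Ioi 0 = Ioo 0 t := by
  refine Subset.antisymm ?_ fun s hs => ?_
  · rintro _ ⟨x, hx, rfl⟩
    exact ⟨by positivity, div_lt_self ht (lt_add_of_pos_right 1 (pow_pos hx 2))⟩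
  · have hpos : 0 < t / s - 1 := sub_pos.2 ((one_lt_div hs.1).2 hs.2)
    refine ⟨√(t / s - 1), Real.sqrt_pos.2 hpos, ?_⟩
    dsimp only
    rw [Real.sq_sqrt hpos.le, add_sub_cancel, div_div_cancel₀ ht.ne']

theorem reflectedKernel_mul_passageDensity_div_one_add_sq (ht : 0 < t) (b c : ℝ) {x : ℝ}
    (hx : 0 < x) :
    2 * t * x / (1 + x ^ 2) ^ 2 *
        (reflectedKernel b (t - t / (1 + x ^ 2)) * passageDensity c (t / (1 + x ^ 2))) =
      c / (Real.pi * t) * Real.exp (-(b ^ 2 + c ^ 2) / (4 * t)) *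
        Real.exp (-(c / (2 * √t) * x) ^ 2 - (b / (2 * √t) / x) ^ 2) := by
  have hsub : t - t / (1 + x ^ 2) = t * x ^ 2 / (1 + x ^ 2) := by field_simp; ring
  have hsqrt : √(4 * Real.pi * (t * x ^ 2 / (1 + x ^ 2))) * √(4 * Real.pi * (t / (1 + x ^ 2))) =
      4 * Real.pi * t * x / (1 + x ^ 2) := by
    rw [← Real.sqrt_mul (by positivity), Real.sqrt_eq_iff_eq_sq (by positivity) (by positivity)]
    ring
  have hexp : Real.exp (-b ^ 2 / (4 * (t * x ^ 2 / (1 + x ^ 2)))) *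
        Real.exp (-c ^ 2 / (4 * (t / (1 + x ^ 2)))) =
      Real.exp (-(b ^ 2 + c ^ 2) / (4 * t)) *
        Real.exp (-(c / (2 * √t) * x) ^ 2 - (b / (2 * √t) / x) ^ 2) := by
    rw [← Real.exp_add, ← Real.exp_add]
    congr 1
    simp only [mul_pow, div_pow, Real.sq_sqrt ht.le]
    field_simp
    ring
  rw [hsub, reflectedKernel, passageDensity, heatKernel, heatKernel, mul_assoc (c / _), ← hexp]
  have hcollect : ∀ E₁ E₂ S₁ S₂ : ℝ, 2 * (E₁ / S₁) * (c / (t / (1 + x ^ 2)) * (E₂ / S₂)) =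
      2 * c * (1 + x ^ 2) / t * (E₁ * E₂) / (S₁ * S₂) := fun E₁ E₂ S₁ S₂ => by
    field_simp
  rw [hcollect, hsqrt]
  field_simp
  ring

/-- The strong Markov property: to be at distance `b + c`, the process must first cover the
distance `c`. -/
theorem causalConv_reflectedKernel_passageDensity {b c : ℝ} (hb : 0 < b) (hc : 0 < c)
    (t : ℝ) : causalConv (reflectedKernel b) (passageDensity c) t = reflectedKernel (b + c) t := by
  rcases le_or_gt t 0 with ht | ht
  · rw [causalConv, Ioo_eq_empty_of_le ht, setIntegral_empty, reflectedKernel_of_nonpos _ ht]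
  rw [causalConv, ← image_div_one_add_sq_Ioi ht,
    integral_image_eq_integral_deriv_smul_of_antitoneOn measurableSet_Ioi
      (fun x _ => (hasDerivAt_div_one_add_sq t x).hasDerivWithinAt)
      (antitoneOn_div_one_add_sq ht)]
  simp only [neg_neg, smul_eq_mul]
  rw [setIntegral_congr_fun measurableSet_Ioi fun x hx =>
      reflectedKernel_mul_passageDensity_div_one_add_sq ht b c hx,
    integral_const_mul, integral_exp_neg_sq_sub_inv_sq (by positivity) (by positivity)]
  have hexp : Real.exp (-(b + c) ^ 2 / (4 * t)) = Real.exp (-(b ^ 2 + c ^ 2) / (4 * t)) *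
      Real.exp (-(2 * (c / (2 * √t)) * (b / (2 * √t)))) := by
    rw [← Real.exp_add]
    congr 1
    field_simp
    rw [Real.sq_sqrt ht.le]
    ring
  have hsqrt : √(4 * Real.pi * t) = 2 * √Real.pi * √t := by
    rw [Real.sqrt_mul (by positivity), Real.sqrt_mul zero_le_four,
      show (4 : ℝ) = 2 ^ 2 by norm_num, Real.sqrt_sq zero_le_two]
  rw [reflectedKernel, heatKernel, hexp, hsqrt]
  field_simp
  rw [Real.sq_sqrt ht.le, Real.sq_sqrt Real.pi_pos.le]

end TimeChange

/-! ### The delay equation and its non-oscillation -/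

/-- Picard iterates for the delay equation `Y' = -a Y(· - 1)` with `Y = 1` on `(-∞, 1]`; the
`n`-th one is exact on `(-∞, n + 1]`. -/
def delayIterate (a : ℝ) : ℕ → ℝ → ℝ
  | 0, _ => 1
  | n + 1, s => 1 - a * ∫ r in (0)..max (s - 1) 0, delayIterate a n r

/-- The solution of the delay equation `Y' = -a Y(· - 1)` on `(1, ∞)` with `Y = 1` on
`(-∞, 1]`. -/
def delaySolution (a s : ℝ) : ℝ := delayIterate a ⌊s⌋₊ s

theorem continuous_delayIterate (a : ℝ) (n : ℕ) : Continuous (delayIterate a n) := by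
  induction n with
  | zero => exact continuous_const
  | succ n ih =>
    have hprim := intervalIntegral.continuous_primitive (μ := volume)
      (fun x y => ih.intervalIntegrable x y) 0
    exact continuous_const.sub (continuous_const.mul (hprim.comp (by fun_prop)))

theorem delayIterate_succ_eq (a : ℝ) {n : ℕ} {s : ℝ} (hs : s ≤ n + 1) :
    delayIterate a (n + 1) s = delayIterate a n s := by
  induction n generalizing s with
  | zero =>
    have hmax : max (s - 1) 0 = 0 := max_eq_right (by simpa using hs)
    simp only [delayIterate, hmax, intervalIntegral.integral_same, mul_zero, sub_zero]
  | succ n ih =>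
    rw [delayIterate, delayIterate]
    congr 2
    refine intervalIntegral.integral_congr fun r hr => ih ?_
    rw [uIcc_of_le (le_max_right _ _)] at hr
    exact hr.2.trans (max_le (by push_cast at hs; linarith) (by positivity))

theorem delayIterate_eq_of_le (a : ℝ) {m n : ℕ} (h : n ≤ m) {s : ℝ} (hs : s ≤ n + 1) :
    delayIterate a m s = delayIterate a n s := by
  induction m, h using Nat.le_induction with
  | base => rfl
  | succ m hm ih => rw [delayIterate_succ_eq a (hs.trans (by gcongr)), ih]

theorem delaySolution_eq_delayIterate (a : ℝ) {n : ℕ} {s : ℝ} (hs : s < n + 1) :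
    delaySolution a s = delayIterate a n s := by
  refine (delayIterate_eq_of_le a ?_ (Nat.lt_floor_add_one s).le).symm
  exact Nat.lt_succ_iff.1 ((Nat.floor_lt' n.succ_ne_zero).2 (by exact_mod_cast hs))

theorem continuous_delaySolution (a : ℝ) : Continuous (delaySolution a) := by
  refine continuous_iff_continuousAt.2 fun s => ?_
  refine (continuous_delayIterate a ⌊s⌋₊).continuousAt.congr ?_
  filter_upwards [Iio_mem_nhds (Nat.lt_floor_add_one s)] with r hr
  exact (delaySolution_eq_delayIterate a hr).symm

theorem delaySolution_eq_one_sub_integral (a s : ℝ) :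
    delaySolution a s = 1 - a * ∫ r in (0)..max (s - 1) 0, delaySolution a r := by
  have hs := Nat.lt_floor_add_one s
  rw [delaySolution_eq_delayIterate a (n := ⌊s⌋₊ + 1) (by push_cast; linarith), delayIterate]
  congr 2
  refine intervalIntegral.integral_congr fun r hr => (delaySolution_eq_delayIterate a ?_).symm
  rw [uIcc_of_le (le_max_right _ _)] at hr
  exact hr.2.trans_lt (max_lt (by linarith) (by positivity))

theorem delaySolution_of_le_one (a : ℝ) {s : ℝ} (hs : s ≤ 1) : delaySolution a s = 1 := by
  rw [delaySolution_eq_one_sub_integral, max_eq_right (sub_nonpos.2 hs),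
    intervalIntegral.integral_same, mul_zero, sub_zero]

theorem hasDerivAt_delaySolution (a : ℝ) {s : ℝ} (hs : 1 < s) :
    HasDerivAt (delaySolution a) (-(a * delaySolution a (s - 1))) s := by
  have hprim := ((continuous_delaySolution a).integral_hasStrictDerivAt 0 (s - 1)).hasDerivAt
  refine (((hprim.comp_sub_const s 1).const_mul a).const_sub 1).congr_of_eventuallyEq ?_
  filter_upwards [Ioi_mem_nhds hs] with r hr
  rw [delaySolution_eq_one_sub_integral, max_eq_left (sub_nonneg.2 (mem_Ioi.1 hr).le)]

theorem monotoneOn_Icc_of_sub_le_deriv {f f' : ℝ → ℝ} {x y : ℝ} (hf : ContinuousOn f (Icc x y))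
    (hf' : ∀ s ∈ Ioo x y, HasDerivAt f (f' s) s) (hle : ∀ s ∈ Ioo x y, f s - f x ≤ f' s) :
    MonotoneOn f (Icc x y) := by
  rw [← interior_Icc] at hf' hle
  have hmono : MonotoneOn (fun s => Real.exp (-s) * (f s - f x)) (Icc x y) := by
    refine monotoneOn_of_hasDerivWithinAt_nonneg (convex_Icc x y)
      (f' := fun s => Real.exp (-s) * (f' s - (f s - f x)))
      (ContinuousOn.mul (by fun_prop) (hf.sub continuousOn_const)) (fun s hs => ?_)
      fun s hs => mul_nonneg (Real.exp_pos _).le (sub_nonneg.2 (hle s hs))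
    refine (((hasDerivAt_neg s).exp.mul ((hf' s hs).sub_const (f x))).congr_deriv
      ?_).hasDerivWithinAt
    ring
  refine monotoneOn_of_hasDerivWithinAt_nonneg (convex_Icc x y) hf
    (fun s hs => (hf' s hs).hasDerivWithinAt) fun s hs => ?_
  have hs' := interior_subset hs
  have h := hmono (left_mem_Icc.2 (hs'.1.trans hs'.2)) hs' hs'.1
  simp only [sub_self, mul_zero] at h
  exact (nonneg_of_mul_nonneg_right h (Real.exp_pos _)).trans (hle s hs)

section NonOscillation

variable {a : ℝ}

theorem exp_mul_delaySolution_nonneg_of_monotoneOn {x : ℝ} (hx : 0 ≤ x)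
    (hmono : MonotoneOn (fun s => Real.exp s * delaySolution a s) (Iic x)) {s : ℝ} (hs : s ≤ x) :
    0 ≤ Real.exp s * delaySolution a s := by
  refine le_trans ?_ (hmono ((min_le_right s 0).trans hx) hs (min_le_left s 0))
  beta_reduce
  rw [delaySolution_of_le_one a ((min_le_right s 0).trans zero_le_one), mul_one]
  positivity

/-- With `Z s = e^s Y s` the delay equation reads `Z' = Z - a e Z(· - 1)`, and `a e ≤ 1` is what
makes the delayed term at most `Z (n + 1)` on the next unit interval. -/
theorem monotoneOn_exp_mul_delaySolution (ha : a ≤ Real.exp (-1)) (n : ℕ) :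
    MonotoneOn (fun s => Real.exp s * delaySolution a s) (Iic (n + 1)) := by
  induction n with
  | zero =>
    refine (Real.exp_monotone.monotoneOn _).congr fun s hs => ?_
    rw [delaySolution_of_le_one a (by simpa using hs), mul_one]
  | succ n ih =>
    set Z : ℝ → ℝ := fun s => Real.exp s * delaySolution a s with hZ
    have hae : a * Real.exp 1 ≤ 1 := by
      rwa [← le_div_iff₀ (Real.exp_pos 1), one_div, ← Real.exp_neg]
    have hderiv : ∀ s, 1 < s → HasDerivAt Z (Z s - a * Real.exp 1 * Z (s - 1)) s := fun s hs => by
      refine ((Real.hasDerivAt_exp s).mul (hasDerivAt_delaySolution a hs)).congr_deriv ?_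
      simp only [hZ, Real.exp_sub]
      field_simp
      ring
    have hdelayed : ∀ s ≤ (n : ℝ) + 2, a * Real.exp 1 * Z (s - 1) ≤ Z (n + 1) := fun s hs => by
      have hs' : s - 1 ≤ n + 1 := by linarith
      have hZ₀ := exp_mul_delaySolution_nonneg_of_monotoneOn (by positivity) ih hs'
      calc a * Real.exp 1 * Z (s - 1) ≤ 1 * Z (s - 1) := by gcongr
        _ ≤ Z (n + 1) := (one_mul _).trans_le (ih hs' self_mem_Iic hs')
    have hnext : MonotoneOn Z (Icc (n + 1) (n + 2)) :=
      monotoneOn_Icc_of_sub_le_deriv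
        (Real.continuous_exp.mul (continuous_delaySolution a)).continuousOn
        (fun s hs => hderiv s (by linarith [hs.1, n.cast_nonneg (α := ℝ)]))
        fun s hs => sub_le_sub_left (hdelayed s hs.2.le) _
    have hunion := ih.union_right hnext isGreatest_Iic (isLeast_Icc (by linarith))
    rwa [Iic_union_Icc_eq_Iic (by linarith), ← one_add_one_eq_two, ← add_assoc,
      ← Nat.cast_add_one] at hunion

theorem delaySolution_nonneg (ha : a ≤ Real.exp (-1)) (s : ℝ) : 0 ≤ delaySolution a s :=
  nonneg_of_mul_nonneg_right (exp_mul_delaySolution_nonneg_of_monotoneOn (by positivity)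
    (monotoneOn_exp_mul_delaySolution ha ⌊s⌋₊) (Nat.lt_floor_add_one s).le) (Real.exp_pos s)

theorem delaySolution_le_one (ha : a ∈ Icc 0 (Real.exp (-1))) (s : ℝ) :
    delaySolution a s ≤ 1 := by
  rw [delaySolution_eq_one_sub_integral, sub_le_self_iff]
  exact mul_nonneg ha.1 (intervalIntegral.integral_nonneg (le_max_right _ _)
    fun r _ => delaySolution_nonneg ha.2 r)

theorem abs_delaySolution_le_one (ha : a ∈ Icc 0 (Real.exp (-1))) (s : ℝ) :
    |delaySolution a s| ≤ 1 := by
  rw [abs_of_nonneg (delaySolution_nonneg ha.2 s)]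
  exact delaySolution_le_one ha s

theorem abs_one_sub_delaySolution_le_one (ha : a ∈ Icc 0 (Real.exp (-1))) (s : ℝ) :
    |1 - delaySolution a s| ≤ 1 := by
  rw [abs_of_nonneg (sub_nonneg.2 (delaySolution_le_one ha s))]
  exact sub_le_self 1 (delaySolution_nonneg ha.2 s)

end NonOscillation

/-! ### The resolvent kernel -/

/-- The passage densities subordinated to the solution `Y` of the delay equation,
`∫₀^∞ Y(s) passageDensity (s + b) ds`. For `b = 1` it is the resolvent kernel of the Volterra
equation satisfied by `uPlus`. -/
def delayKernel (a b t : ℝ) : ℝ := ∫ s in Ioi 0, delaySolution a s * passageDensity (s + b) t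

theorem measurable_delaySolution_mul_passageDensity (a b : ℝ) :
    Measurable fun p : ℝ × ℝ => delaySolution a p.2 * passageDensity (p.2 + b) p.1 :=
  ((continuous_delaySolution a).measurable.comp measurable_snd).mul
    (measurable_passageDensity_uncurry.comp ((measurable_snd.add_const b).prodMk measurable_fst))

theorem measurable_delayKernel (a b : ℝ) : Measurable (delayKernel a b) :=
  StronglyMeasurable.measurable
    (measurable_delaySolution_mul_passageDensity a b).stronglyMeasurable.integral_prod_right'

section DelayKernel

variable {a b : ℝ}

theorem delaySolution_mul_passageDensity_nonneg (ha : a ≤ Real.exp (-1)) (hb : 0 ≤ b) (t : ℝ)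
    {s : ℝ} (hs : 0 < s) : 0 ≤ delaySolution a s * passageDensity (s + b) t :=
  mul_nonneg (delaySolution_nonneg ha s) (passageDensity_nonneg (add_nonneg hs.le hb) t)

theorem delayKernel_nonneg (ha : a ≤ Real.exp (-1)) (hb : 0 ≤ b) (t : ℝ) :
    0 ≤ delayKernel a b t :=
  setIntegral_nonneg measurableSet_Ioi fun _ hs =>
    delaySolution_mul_passageDensity_nonneg ha hb t hs

theorem integrableOn_delaySolution_mul_passageDensity (ha : a ∈ Icc 0 (Real.exp (-1)))
    (hb : 0 ≤ b) (t : ℝ) :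
    IntegrableOn (fun s => delaySolution a s * passageDensity (s + b) t) (Ioi 0) :=
  (integrableOn_passageDensity_add hb).bdd_mul
    (continuous_delaySolution a).aestronglyMeasurable (.of_forall (abs_delaySolution_le_one ha))

theorem delayKernel_le_reflectedKernel (ha : a ∈ Icc 0 (Real.exp (-1))) (hb : 0 ≤ b) (t : ℝ) :
    delayKernel a b t ≤ reflectedKernel b t := by
  rw [← integral_passageDensity_add hb]
  refine setIntegral_mono_on (integrableOn_delaySolution_mul_passageDensity ha hb t)
    (integrableOn_passageDensity_add hb) measurableSet_Ioi fun s hs => ?_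
  exact mul_le_of_le_one_left (passageDensity_nonneg (add_nonneg (mem_Ioi.1 hs).le hb) t)
    (delaySolution_le_one ha s)

theorem abs_delayKernel_le (ha : a ∈ Icc 0 (Real.exp (-1))) (hb : 0 < b) (t : ℝ) :
    |delayKernel a b t| ≤ 2 * |b|⁻¹ := by
  rw [abs_of_nonneg (delayKernel_nonneg ha.2 hb.le t)]
  exact (delayKernel_le_reflectedKernel ha hb.le t).trans
    ((le_abs_self _).trans (abs_reflectedKernel_le hb.ne' t))

theorem reflectedKernel_sub_delayKernel (ha : a ∈ Icc 0 (Real.exp (-1))) (hb : 0 ≤ b) (t : ℝ) :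
    reflectedKernel b t - delayKernel a b t =
      ∫ s in Ioi 0, (1 - delaySolution a (s + 1)) * passageDensity (s + (1 + b)) t := by
  calc reflectedKernel b t - delayKernel a b t
      = ∫ s in Ioi 0, (1 - delaySolution a s) * passageDensity (s + b) t := by
        rw [← integral_passageDensity_add hb, delayKernel,
          ← integral_sub (integrableOn_passageDensity_add hb)
            (integrableOn_delaySolution_mul_passageDensity ha hb t)]
        simp only [sub_mul, one_mul]
    _ = ∫ s in Ioi 1, (1 - delaySolution a s) * passageDensity (s + b) t := by
        refine setIntegral_eq_of_subset_of_forall_sdiff_eq_zero measurableSet_Ioi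
          (Ioi_subset_Ioi zero_le_one) fun s hs => ?_
        rw [delaySolution_of_le_one a (not_lt.1 hs.2), sub_self, zero_mul]
    _ = ∫ s in Ioi 0, (1 - delaySolution a (s + 1)) * passageDensity (s + (1 + b)) t := by
        rw [← integral_indicator measurableSet_Ioi, ← integral_indicator measurableSet_Ioi,
          ← integral_add_right_eq_self _ (1 : ℝ)]
        simp only [indicator, mem_Ioi, lt_add_iff_pos_left, add_assoc]

theorem mul_integral_delaySolution_mul_reflectedKernel (ha : a ∈ Icc 0 (Real.exp (-1)))
    (hb : 0 ≤ b) (t : ℝ) :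
    a * ∫ s in Ioi 0, delaySolution a s * reflectedKernel (s + (1 + b)) t =
      reflectedKernel b t - delayKernel a b t := by
  have hY := continuous_delaySolution a
  have hR : Continuous fun s => reflectedKernel (s + (1 + b)) t :=
    (continuous_const.mul (continuous_heatKernel t)).comp (by fun_prop)
  have hRi : Integrable fun s => reflectedKernel (s + (1 + b)) t :=
    ((integrable_heatKernel t).const_mul 2).comp_add_right (1 + b)
  have hu' : ∀ s ∈ Ioi (0 : ℝ),
      HasDerivAt (fun s => 1 - delaySolution a (s + 1)) (a * delaySolution a s) s := fun s hs => by
    have h := (hasDerivAt_delaySolution a (lt_add_of_pos_left 1 hs)).comp_add_const s 1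
    simpa only [neg_neg, add_sub_cancel_right] using h.const_sub 1
  have hzero : Tendsto ((fun s => 1 - delaySolution a (s + 1)) *
      fun s => -reflectedKernel (s + (1 + b)) t) (𝓝[>] 0) (𝓝 0) := by
    refine (Continuous.tendsto' (by fun_prop) 0 0 ?_).mono_left nhdsWithin_le_nhds
    rw [Pi.mul_apply, zero_add, delaySolution_of_le_one a le_rfl, sub_self, zero_mul]
  have hinfty : Tendsto ((fun s => 1 - delaySolution a (s + 1)) *
      fun s => -reflectedKernel (s + (1 + b)) t) atTop (𝓝 0) :=
    isBoundedUnder_le_mul_tendsto_zero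
      (isBoundedUnder_of ⟨1, fun s => abs_one_sub_delaySolution_le_one ha (s + 1)⟩)
      tendsto_neg_reflectedKernel_add
  have hparts := integral_Ioi_mul_deriv_eq_deriv_mul hu'
    (fun s _ => hasDerivAt_neg_reflectedKernel_add s)
    ((integrableOn_passageDensity_add (by positivity)).bdd_mul (by fun_prop)
      (.of_forall fun s => abs_one_sub_delaySolution_le_one ha (s + 1)))
    (hRi.neg.integrableOn.bdd_mul (c := |a|) (by fun_prop) (.of_forall fun s => by
      rw [norm_mul]
      exact mul_le_of_le_one_right (abs_nonneg a) (abs_delaySolution_le_one ha s)))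
    hzero hinfty
  rw [reflectedKernel_sub_delayKernel ha hb, hparts, sub_zero, zero_sub, ← integral_neg,
    ← integral_const_mul]
  simp only [mul_neg, neg_neg, mul_assoc]

theorem integrable_uncurry_delaySolution_mul_passageDensity (ha : a ∈ Icc 0 (Real.exp (-1)))
    (hb : 0 < b) (t : ℝ) :
    Integrable (Function.uncurry fun τ s => delaySolution a s * passageDensity (s + b) τ)
      ((volume.restrict (Ioo 0 t)).prod (volume.restrict (Ioi 0))) := by
  refine integrable_uncurry_of_integral_le (measurable_delaySolution_mul_passageDensity a b)
    (.of_forall fun τ => ?_)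
    (.of_forall fun τ => integrableOn_delaySolution_mul_passageDensity ha hb.le τ)
    (.of_forall fun τ => (le_abs_self _).trans (abs_delayKernel_le ha hb τ))
  filter_upwards [ae_restrict_mem measurableSet_Ioi] with s hs
  exact delaySolution_mul_passageDensity_nonneg ha.2 hb.le τ hs

theorem mul_causalConv_reflectedKernel_delayKernel (ha : a ∈ Icc 0 (Real.exp (-1))) (hb : 0 < b)
    (t : ℝ) :
    a * causalConv (reflectedKernel b) (delayKernel a 1) t =
      reflectedKernel b t - delayKernel a b t := by
  rw [← mul_integral_delaySolution_mul_reflectedKernel ha hb.le]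
  congr 1
  refine (causalConv_integral (measurable_reflectedKernel b) (abs_reflectedKernel_le hb.ne')
    (integrable_uncurry_delaySolution_mul_passageDensity ha one_pos t)).trans
    (setIntegral_congr_fun measurableSet_Ioi fun s hs => ?_)
  rw [← add_assoc, add_comm (s + 1) b,
    ← causalConv_reflectedKernel_passageDensity hb (add_pos hs one_pos)]
  simp only [causalConv, ← integral_const_mul, mul_left_comm]

end DelayKernel

/-! ### Point evaluation in `H¹(ℝ)` -/

theorem HasWeakDeriv.exists_ae_eq_const_add_primitive {f g : ℝ → ℝ} (hf : LocallyIntegrable f)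
    (hg : LocallyIntegrable g) (h : HasWeakDeriv f g) :
    ∃ c, f =ᵐ[volume] fun x => c + ∫ y in (0 : ℝ)..x, g y := by
  have hcont : Continuous fun x => ∫ y in (0 : ℝ)..x, g y :=
    intervalIntegral.continuous_primitive
      (fun a b => (hg.integrableOn_isCompact isCompact_uIcc).intervalIntegrable) 0
  obtain ⟨c, hc⟩ := ae_const_of_weakDeriv_zero (hf.sub hcont.locallyIntegrable) fun φ hφ hφc => by
    have hfφ : Integrable fun x => f x * deriv φ x := by
      simpa only [smul_eq_mul, mul_comm] using
        hf.integrable_smul_left_of_hasCompactSupport (deriv_test hφ) hφc.deriv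
    have hgφ : Integrable fun x => (∫ y in (0 : ℝ)..x, g y) * deriv φ x :=
      (hcont.mul (deriv_test hφ)).integrable_of_hasCompactSupport hφc.deriv.mul_left
    simp only [Pi.sub_apply, sub_mul]
    rw [integral_sub hfφ hgφ, h φ hφ hφc, integral_primitive_mul_deriv hg hφ hφc, sub_self]
  exact ⟨c, hc.mono fun x hx => sub_eq_iff_eq_add.1 hx⟩

theorem setIntegral_abs_le_norm {X : Type*} [MeasurableSpace X] {μ : Measure X} (f : Lp ℝ 2 μ)
    {s : Set X} (hs : μ s = 1) : ∫ x in s, |f x| ∂μ ≤ ‖f‖ := by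
  have : IsProbabilityMeasure (μ.restrict s) := ⟨by rw [Measure.restrict_apply_univ, hs]⟩
  have hf : AEStronglyMeasurable f (μ.restrict s) := (Lp.aestronglyMeasurable f).restrict
  simp only [← Real.norm_eq_abs]
  rw [integral_norm_eq_lintegral_enorm hf, ← eLpNorm_one_eq_lintegral_enorm, Lp.norm_def]
  refine ENNReal.toReal_mono (Lp.eLpNorm_ne_top f) ?_
  exact (eLpNorm_le_eLpNorm_of_exponent_le one_le_two hf).trans
    (eLpNorm_mono_measure _ Measure.restrict_le_self)

namespace H1

theorem rep_eq_of_ae_eq {f : H1} {g : ℝ → ℝ} (hg : Continuous g) (h : f.fn =ᵐ[volume] g) :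
    f.rep = g :=
  (f.continuous_rep.ae_eq_iff_eq volume hg).1 (f.fn_ae_eq_rep.symm.trans h)

theorem rep_add (f g : H1) : (f + g).rep = f.rep + g.rep :=
  rep_eq_of_ae_eq (f.continuous_rep.add g.continuous_rep)
    ((Lp.coeFn_add f.1.fst g.1.fst).trans (f.fn_ae_eq_rep.add g.fn_ae_eq_rep))

theorem rep_smul (c : ℝ) (f : H1) : (c • f).rep = c • f.rep :=
  rep_eq_of_ae_eq (f.continuous_rep.const_smul c)
    ((Lp.coeFn_smul c f.1.fst).trans (f.fn_ae_eq_rep.const_smul c))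

theorem rep_nonneg {f : H1} (hf : ∀ᵐ x : ℝ, 0 ≤ f.fn x) (x : ℝ) : 0 ≤ f.rep x := by
  have habs : f.rep = fun x => |f.rep x| := by
    refine rep_eq_of_ae_eq f.continuous_rep.abs ?_
    filter_upwards [hf, f.fn_ae_eq_rep] with y hy hrep
    rw [← hrep, abs_of_nonneg hy]
  rw [habs]
  exact abs_nonneg _

theorem intervalIntegrable_snd (f : H1) (x y : ℝ) : IntervalIntegrable f.1.snd volume x y :=
  (((Lp.memLp f.1.snd).locallyIntegrable one_le_two).integrableOn_isCompact
    isCompact_uIcc).intervalIntegrable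

theorem rep_sub_rep (f : H1) (x y : ℝ) : f.rep y - f.rep x = ∫ z in x..y, f.1.snd z := by
  obtain ⟨c, hc⟩ := f.2.exists_ae_eq_const_add_primitive
    ((Lp.memLp f.1.fst).locallyIntegrable one_le_two)
    ((Lp.memLp f.1.snd).locallyIntegrable one_le_two)
  have hrep : f.rep = fun x => c + ∫ z in (0 : ℝ)..x, f.1.snd z :=
    rep_eq_of_ae_eq (continuous_const.add
      (intervalIntegral.continuous_primitive f.intervalIntegrable_snd 0)) hc
  simp only [hrep, add_sub_add_left_eq_sub]
  exact intervalIntegral.integral_interval_sub_left (f.intervalIntegrable_snd 0 y)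
    (f.intervalIntegrable_snd 0 x)

theorem abs_rep_sub_rep_le (f : H1) {x y : ℝ} (hy : y ∈ Icc x (x + 1)) :
    |f.rep y - f.rep x| ≤ ‖f‖ := by
  have hint : IntegrableOn (fun z => |f.1.snd z|) (Icc x (x + 1)) :=
    (((Lp.memLp f.1.snd).locallyIntegrable one_le_two).integrableOn_isCompact isCompact_Icc).abs
  calc |f.rep y - f.rep x| = |∫ z in x..y, f.1.snd z| := by rw [rep_sub_rep]
    _ ≤ ∫ z in x..y, |f.1.snd z| := intervalIntegral.abs_integral_le_integral_abs hy.1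
    _ = ∫ z in Ioc x y, |f.1.snd z| := intervalIntegral.integral_of_le hy.1
    _ ≤ ∫ z in Icc x (x + 1), |f.1.snd z| :=
        setIntegral_mono_set hint (.of_forall fun z => abs_nonneg _)
          (Ioc_subset_Icc_self.trans (Icc_subset_Icc_right hy.2)).eventuallyLE
    _ ≤ ‖f.1.snd‖ := setIntegral_abs_le_norm _ (by simp)
    _ ≤ ‖f‖ := WithLp.norm_snd_le (x := f.1)

-- On `[x, x + 1]` the function `|f|` is somewhere at most its mean, which `‖f‖` bounds.
theorem abs_rep_le (f : H1) (x : ℝ) : |f.rep x| ≤ 2 * ‖f‖ := by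
  have hvol : volume (Icc x (x + 1)) = 1 := by simp
  obtain ⟨y, hy, hmean⟩ := exists_le_setAverage (μ := volume) (s := Icc x (x + 1))
    (f := fun y => |f.rep y|) (by simp [hvol]) (by simp [hvol])
    f.continuous_rep.abs.continuousOn.integrableOn_Icc
  have hrep_y : |f.rep y| ≤ ‖f‖ :=
    calc |f.rep y| ≤ ∫ z in Icc x (x + 1), |f.rep z| := by
          simpa [setAverage_eq, measureReal_def, hvol] using hmean
      _ = ∫ z in Icc x (x + 1), |f.1.fst z| :=
          integral_congr_ae (ae_restrict_of_ae (f.fn_ae_eq_rep.symm.fun_comp abs))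
      _ ≤ ‖f.1.fst‖ := setIntegral_abs_le_norm _ hvol
      _ ≤ ‖f‖ := WithLp.norm_fst_le (x := f.1)
  calc |f.rep x| = |f.rep y - (f.rep y - f.rep x)| := by rw [sub_sub_cancel]
    _ ≤ |f.rep y| + |f.rep y - f.rep x| := abs_sub _ _
    _ ≤ 2 * ‖f‖ := by linarith [f.abs_rep_sub_rep_le hy]

/-- Evaluation of the continuous representative at a point, as a bounded functional on `H¹(ℝ)`. -/
def eval (x : ℝ) : H1 →L[ℝ] ℝ :=
  LinearMap.mkContinuous
    { toFun := fun f => f.rep x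
      map_add' := fun f g => by rw [rep_add, Pi.add_apply]
      map_smul' := fun c f => by rw [rep_smul, Pi.smul_apply, RingHom.id_apply] }
    2 fun f => f.abs_rep_le x

@[simp]
theorem eval_apply (x : ℝ) (f : H1) : eval x f = f.rep x := rfl

end H1

theorem rep_heatKernelH1 {t : ℝ} (ht : 0 < t) : (heatKernelH1 t).rep = heatKernel t :=
  H1.rep_eq_of_ae_eq (continuous_heatKernel t) (heatKernelH1_fn ht)

/-! ### Heat flow and mild solutions -/

theorem heatFlow_congr_ae {f g : ℝ → ℝ} (h : f =ᵐ[volume] g) (t : ℝ) :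
    heatFlow t f = heatFlow t g :=
  funext fun x => integral_congr_ae ((ae_eq_refl fun y => heatKernel t (x - y)).mul h)

theorem continuous_heatFlow {f : ℝ → ℝ} (hf : Continuous f) {M : ℝ} (hfM : ∀ y, |f y| ≤ M)
    (t : ℝ) : Continuous (heatFlow t f) := by
  have heq : heatFlow t f = fun x => ∫ y, heatKernel t y * f (x - y) := by
    funext x
    rw [heatFlow, ← integral_sub_left_eq_self _ volume x]
    simp only [sub_sub_cancel]
  have hk := continuous_heatKernel t
  rw [heq]
  refine continuous_of_dominated (bound := fun y => heatKernel t y * M)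
    (fun x => Continuous.aestronglyMeasurable (by fun_prop)) (fun x => .of_forall fun y => ?_)
    ((integrable_heatKernel t).mul_const _) (.of_forall fun y => by fun_prop)
  rw [norm_mul, Real.norm_of_nonneg (heatKernel_nonneg t y)]
  exact mul_le_mul_of_nonneg_left (hfM _) (heatKernel_nonneg t y)

section MildSolution

variable {a : ℝ} {Φ : ℝ → ℝ} {u₀ : H1} {u : ℝ → H1} (hu : IsMildSolution a Φ u₀ u)

include hu

theorem IsMildSolution.rep_eq {t : ℝ} (ht : 0 < t) (x : ℝ) :
    (u t).rep x = heatFlow t u₀.rep x +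
      ∫ τ in Ioo 0 t, intensity a Φ u τ * heatKernel (t - τ) x := by
  have hrep : (u t).rep = heatFlow t u₀.rep +
      (∫ τ in Ioo 0 t, intensity a Φ u τ • heatKernelH1 (t - τ) : H1).rep := by
    refine H1.rep_eq_of_ae_eq
      ((continuous_heatFlow u₀.continuous_rep u₀.abs_rep_le t).add (H1.continuous_rep _)) ?_
    rw [← heatFlow_congr_ae u₀.fn_ae_eq_rep]
    exact (hu.variation_of_constants t ht).trans ((ae_eq_refl _).add (H1.fn_ae_eq_rep _))
  rw [hrep, Pi.add_apply, ← H1.eval_apply x (∫ τ in Ioo 0 t, _),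
    ← ContinuousLinearMap.integral_comp_comm _ (hu.integrable t ht)]
  congr 1
  refine setIntegral_congr_fun measurableSet_Ioo fun τ hτ => ?_
  simp only [map_smul, H1.eval_apply, smul_eq_mul, rep_heatKernelH1 (sub_pos.2 hτ.2)]

theorem IsMildSolution.continuousOn_uPlus : ContinuousOn (uPlus u) (Ici 0) :=
  ((H1.eval 1).continuous.comp_continuousOn hu.continuousOn).add
    ((H1.eval (-1)).continuous.comp_continuousOn hu.continuousOn)

theorem IsMildSolution.integrableOn_uPlus (t : ℝ) : IntegrableOn (uPlus u) (Ioo 0 t) :=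
  (hu.continuousOn_uPlus.mono Icc_subset_Ici_self).integrableOn_Icc.mono_set Ioo_subset_Icc_self

-- The kernel `heatKernel (t + 1 - τ) 0` is bounded below for `τ < t`, so integrability of the
-- Duhamel integrand up to time `t + 1`, evaluated at `0`, carries over to the intensity.
theorem IsMildSolution.integrableOn_intensity {t : ℝ} (ht : 0 < t) :
    IntegrableOn (intensity a Φ u) (Ioo 0 t) := by
  have heval : IntegrableOn (fun τ => intensity a Φ u τ * heatKernel (t + 1 - τ) 0) (Ioo 0 t) := by
    refine (((H1.eval 0).integrable_comp (hu.integrable (t + 1) (by linarith))).mono_measure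
      (Measure.restrict_mono (Ioo_subset_Ioo_right (by linarith)) le_rfl)).congr ?_
    filter_upwards [ae_restrict_mem measurableSet_Ioo] with τ hτ
    simp only [map_smul, H1.eval_apply, smul_eq_mul,
      rep_heatKernelH1 (show 0 < t + 1 - τ by linarith [hτ.2])]
  refine (heval.mul_continuousOn_of_subset (g' := fun τ => √(4 * Real.pi * (t + 1 - τ)))
    (Continuous.continuousOn (by fun_prop)) measurableSet_Ioo isCompact_Icc
    Ioo_subset_Icc_self).congr_fun (fun τ hτ => ?_) measurableSet_Ioo
  have hsqrt : √(4 * Real.pi * (t + 1 - τ)) ≠ 0 :=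
    (Real.sqrt_pos.2 (mul_pos (by positivity) (by linarith [hτ.2]))).ne'
  simp [heatKernel, hsqrt]

theorem IsMildSolution.integrableOn_source {t : ℝ} (ht : 0 < t) : IntegrableOn Φ (Ioo 0 t) := by
  refine ((hu.integrableOn_intensity ht).add ((hu.integrableOn_uPlus t).const_mul a)).congr
    (.of_forall fun τ => ?_)
  simp only [Pi.add_apply, intensity, sub_add_cancel]

theorem IsMildSolution.uPlus_eq {t : ℝ} (ht : 0 < t) :
    uPlus u t = heatFlow t u₀.rep 1 + heatFlow t u₀.rep (-1) +
      causalConv (reflectedKernel 1) (intensity a Φ u) t := by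
  rw [uPlus, hu.rep_eq ht, hu.rep_eq ht]
  simp only [heatKernel_neg, causalConv, reflectedKernel, mul_assoc, integral_const_mul,
    mul_comm (intensity a Φ u _)]
  ring

end MildSolution

theorem integrable_uncurry_heatKernel_sub (t x : ℝ) :
    Integrable (Function.uncurry fun s y => heatKernel s (x - y))
      ((volume.restrict (Ioo 0 t)).prod volume) := by
  have hmeas : Measurable fun p : ℝ × ℝ => heatKernel p.1 (x - p.2) := by fun_prop [heatKernel]
  refine integrable_uncurry_of_integral_le (C := 1) hmeas
    (.of_forall fun s => .of_forall fun y => heatKernel_nonneg s (x - y))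
    (.of_forall fun s => (integrable_heatKernel s).comp_sub_left x) ?_
  filter_upwards [ae_restrict_mem measurableSet_Ioo] with s hs
  rw [integral_sub_left_eq_self (heatKernel s) volume x, integral_heatKernel hs.1]

section HeatFlow

variable {v : ℝ → ℝ} {M : ℝ} (hv : Continuous v) (hvM : ∀ y, |v y| ≤ M)

include hv hvM

theorem integrable_uncurry_heatKernel_sub_mul (t x : ℝ) :
    Integrable (Function.uncurry fun s y => heatKernel s (x - y) * v y)
      ((volume.restrict (Ioo 0 t)).prod volume) :=
  (integrable_uncurry_heatKernel_sub t x).mul_bdd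
    (hv.comp continuous_snd).aestronglyMeasurable (.of_forall fun p => hvM p.2)

theorem integrableOn_heatFlow (t x : ℝ) : IntegrableOn (fun s => heatFlow s v x) (Ioo 0 t) :=
  (integrable_uncurry_heatKernel_sub_mul hv hvM t x).integral_prod_left

end HeatFlow

section Positivity

variable {a : ℝ} (ha : a ∈ Icc 0 (Real.exp (-1)))

include ha

theorem mul_causalConv_delayKernel_heatKernel_le {z : ℝ} (hz : z ≠ 0) (t : ℝ) :
    a * causalConv (delayKernel a 1) (fun s => heatKernel s z) t ≤ heatKernel t z := by
  have hz' : 0 < |z| := abs_pos.2 hz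
  have htwo : 2 * (a * causalConv (delayKernel a 1) (fun s => heatKernel s z) t) =
      2 * heatKernel t z - delayKernel a |z| t := by
    have hconv := mul_causalConv_reflectedKernel_delayKernel ha hz' t
    rw [causalConv_comm] at hconv
    simp only [reflectedKernel, heatKernel_abs, causalConv, mul_left_comm _ (2 : ℝ),
      integral_const_mul] at hconv
    simpa only [causalConv, mul_left_comm _ (2 : ℝ)] using hconv
  linarith [delayKernel_nonneg ha.2 hz'.le t]

theorem mul_causalConv_delayKernel_heatFlow_le {v : ℝ → ℝ} {M : ℝ} (hv : Continuous v)
    (hv₀ : ∀ y, 0 ≤ v y) (hvM : ∀ y, |v y| ≤ M) (t x : ℝ) :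
    a * causalConv (delayKernel a 1) (fun s => heatFlow s v x) t ≤ heatFlow t v x := by
  have hpointwise : ∀ᵐ y, a * causalConv (delayKernel a 1) (fun s => heatKernel s (x - y) * v y) t ≤
      heatKernel t (x - y) * v y := by
    filter_upwards [Measure.ae_ne volume x] with y hy
    have hle := mul_le_mul_of_nonneg_right
      (mul_causalConv_delayKernel_heatKernel_le ha (sub_ne_zero.2 hy.symm) t) (hv₀ y)
    simpa only [causalConv, ← mul_assoc, integral_mul_const] using hle
  simp only [heatFlow]
  rw [causalConv_integral (measurable_delayKernel a 1) (abs_delayKernel_le ha one_pos)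
    (integrable_uncurry_heatKernel_sub_mul hv hvM t x), ← integral_const_mul]
  refine integral_mono_of_nonneg (.of_forall fun y => mul_nonneg ha.1 ?_)
    (((integrable_heatKernel t).comp_sub_left x).mul_bdd hv.aestronglyMeasurable
      (.of_forall hvM)) hpointwise
  exact causalConv_nonneg (delayKernel_nonneg ha.2 zero_le_one)
    (.of_forall fun s _ => mul_nonneg (heatKernel_nonneg s _) (hv₀ y)) t

theorem IsMildSolution.uPlus_eq_resolvent {Φ : ℝ → ℝ} {u₀ : H1} {u : ℝ → H1}
    (hu : IsMildSolution a Φ u₀ u) {t : ℝ} (ht : 0 < t) :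
    uPlus u t =
      (heatFlow t u₀.rep 1 - a * causalConv (delayKernel a 1) (fun s => heatFlow s u₀.rep 1) t) +
      (heatFlow t u₀.rep (-1) -
        a * causalConv (delayKernel a 1) (fun s => heatFlow s u₀.rep (-1)) t) +
      causalConv (delayKernel a 1) Φ t := by
  have hv (x : ℝ) := integrableOn_heatFlow u₀.continuous_rep u₀.abs_rep_le t x
  have hr := measurable_delayKernel a 1
  have hrC := abs_delayKernel_le ha one_pos
  have hresolvent (s : ℝ) : a * causalConv (delayKernel a 1) (reflectedKernel 1) s =
      reflectedKernel 1 s - delayKernel a 1 s := by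
    rw [causalConv_comm, mul_causalConv_reflectedKernel_delayKernel ha one_pos]
  rw [eq_of_volterra_of_resolvent (measurable_reflectedKernel 1)
    (abs_reflectedKernel_le one_ne_zero) (fun s hs => reflectedKernel_of_nonpos 1 hs) hr hrC
    (hu.integrableOn_source ht) ((hv 1).add (hv (-1))) (hu.integrableOn_uPlus t) hresolvent
    (fun s hs => hu.uPlus_eq hs.1) ht, Pi.add_def, causalConv_add hr hrC (hv 1) (hv (-1))]
  ring

end Positivity

end

end NonlocalHeat

theorem theorem4p9_general (a : ℝ) (ha : a ∈ Set.Icc 0 (Real.exp (-1)))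
    (Φ : ℝ → ℝ) (hΦ_nonneg : ∀ᵐ t : ℝ, 0 ≤ t → 0 ≤ Φ t)
    (u₀ : NonlocalHeat.H1) (hu₀_nonneg : ∀ᵐ x : ℝ, 0 ≤ u₀.fn x)
    (u : ℝ → NonlocalHeat.H1) (hu : NonlocalHeat.IsMildSolution a Φ u₀ u) :
    ∀ t : ℝ, 0 ≤ t → 0 ≤ NonlocalHeat.uPlus u t := by
  intro t ht
  have hrep_nonneg := NonlocalHeat.H1.rep_nonneg hu₀_nonneg
  rcases ht.eq_or_lt with rfl | ht
  · rw [NonlocalHeat.uPlus, hu.initial]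
    exact add_nonneg (hrep_nonneg 1) (hrep_nonneg (-1))
  have hfree (x : ℝ) := sub_nonneg.2 (NonlocalHeat.mul_causalConv_delayKernel_heatFlow_le ha
    u₀.continuous_rep hrep_nonneg u₀.abs_rep_le t x)
  have hforced := NonlocalHeat.causalConv_nonneg
    (NonlocalHeat.delayKernel_nonneg ha.2 zero_le_one) hΦ_nonneg t
  rw [hu.uPlus_eq_resolvent ha ht]
  exact add_nonneg (add_nonneg (hfree 1) (hfree (-1))) hforced

theorem theorem4p9 (a : ℝ) (ha : a ∈ Set.Icc 0 (Real.exp (-1)))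
    (Φ : ℝ → ℝ) (hΦ_loc : NonlocalHeat.IsLocBounded Φ) (hΦ_exp : NonlocalHeat.IsExpOrder Φ)
    (hΦ_nonneg : ∀ᵐ t : ℝ, 0 ≤ t → 0 ≤ Φ t)
    (u₀ : NonlocalHeat.H1) (hu₀_nonneg : ∀ᵐ x : ℝ, 0 ≤ u₀.fn x)
    (u : ℝ → NonlocalHeat.H1) (hu : NonlocalHeat.IsMildSolution a Φ u₀ u) :
    ∀ t : ℝ, 0 ≤ t → 0 ≤ NonlocalHeat.uPlus u t :=
  theorem4p9_general a ha Φ hΦ_nonneg u₀ hu₀_nonneg u hu
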